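/- Let $\mathbb{D}=\{z\in\mathbb{C}:|z|<1\}$ and let $c\in(0,2]$. Let $\mathcal{F}(c)$ be the class of analytic functions $f:\mathbb{D}\to\mathbb{C}$ with $f(0)=0$, $f'(0)=1$, $f'(z)\neq 0$ and $$\operatorname{Re}\left(1+\frac{zf''(z)}{f'(z)}\right)>1-\frac{c}{2}\qquad (z\in\mathbb{D}).$$ The logarithmic coefficients $\gamma_n=\gamma_n(f)$ are defined by $\log\frac{f(z)}{z}=2\sum_{n=1}^{\infty}\gamma_n z^n$ near the origin, where $f(z)/z$ is given the value $1$ at $z=0$ and the branch of the logarithm is the one vanishing at $z=0$. Put $$f_c(z)=\frac{(1-z)^{1-c}-1}{c-1}\quad(c\neq 1),\qquad f_1(z)=-\log(1-z),$$ with principal branches, and let $\psi(z)=\frac{zf_c'(z)}{f_c(z)}=1+\sum_{n=1}^{\infty}D_nz^n$ (with $\psi(0)=1$). All sums below are taken in $[0,\infty]$. Then every $f\in\mathcal{F}(c)$ satisfies $$\sum_{n=1}^{\infty}n^2|\gamma_n|^2\le\frac14\sum_{n=1}^{\infty}|D_n|^2$$ and, for every real $t\le 2$, $$\sum_{n=1}^{\infty}(n+1)^t|\gamma_n|^2\le\frac14\sum_{n=1}^{\infty}\frac{(n+1)^t}{n^2}|D_n|^2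 .$$ The first inequality is sharp: $f_c\in\mathcal{F}(c)$, and equality holds in it for $f=f_c$. -/

import Mathlib

noncomputable section

namespace LogCoeffs

/-- The open unit disk. -/
abbrev unitDisk : Set ℂ := Metric.ball 0 1

/-- The class `𝒜` of analytic functions on the unit disk with `f(0) = 0`, `f'(0) = 1`. -/
structure ClassA (f : ℂ → ℂ) : Prop where
  analytic : DifferentiableOn ℂ f unitDisk
  map_zero : f 0 = 0
  deriv_zero : deriv f 0 = 1

/-- The class `ℱ(c)`: functions of class `𝒜` such that `f'` has no zero in the unit disk and
`Re (1 + z f''(z) / f'(z)) > 1 - c / 2` there. -/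
structure ClassF (c : ℝ) (f : ℂ → ℂ) : Prop extends ClassA f where
  deriv_ne_zero : ∀ z ∈ unitDisk, deriv f z ≠ 0
  re_gt : ∀ z ∈ unitDisk, 1 - c / 2 < (1 + z * deriv (deriv f) z / deriv f z).re

/-- The `n`-th Taylor coefficient at the origin. -/
def taylorCoeff (g : ℂ → ℂ) (n : ℕ) : ℂ := iteratedDeriv n g 0 / (n.factorial : ℂ)

/-- The logarithmic coefficients `γ_n`, given by `log (f(z) / z) = 2 ∑ γ_n z ^ n`, where
`f(z) / z` takes the value `1` at the origin and the logarithm vanishes there. Taylor coefficients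
at the origin depend only on values near the origin, where this logarithm is the principal one. -/
def logCoeff (f : ℂ → ℂ) (n : ℕ) : ℂ :=
  taylorCoeff (fun z => Complex.log (if z = 0 then 1 else f z / z)) n / 2

/-- The function `f_c`. The power and the logarithm are the principal ones. -/
def extremal (c : ℝ) (z : ℂ) : ℂ :=
  if c = 1 then -Complex.log (1 - z)
  else ((1 - z) ^ (1 - (c : ℂ)) - 1) / ((c : ℂ) - 1)

/-- The function `ψ(z) = z f_c'(z) / f_c(z)`, with its removable singularity at the origin
filled in by the value `1`. -/
def psi (c : ℝ) (z : ℂ) : ℂ :=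
  if z = 0 then 1 else z * deriv (extremal c) z / extremal c z

end LogCoeffs

end

/-!
For `f` in `ℱ(c)`, the function `u = f / (z f')` solves `z u' = 1 - P u` with
`P = 1 + z f'' / f'`. For `f_c` the coefficient `P` is `P_c = 1 + c z / (1 - z)`, which maps the
disk onto the half-plane `Re > 1 - c / 2`; hence `P ≺ P_c` for every `f`.

Subordination of the coefficients passes to the solutions. The solution `v` of the extremal
equation is univalent because `- log v` is close-to-convex. If `u` left the image of `v`, then at
the first contact `u z₀ = v ζ₀` Jack's lemma would give `z₀ u'(z₀) = m ζ₀ v'(ζ₀)` with `m ≥ 1`,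
while comparing the two equations there forces `m < 1`. So `u ≺ v`, that is, `z f' / f ≺ ψ`.

The Taylor coefficients of `z f' / f` are `2 n γ_n`. By Rogosinski's theorem the partial sums of
their squared moduli are dominated by those of `|D_n|²`, and Abel summation carries this over to
every antitone weight, in particular to `1` and to `(n + 1) ^ t / n²` for `t ≤ 2`.
-/

namespace LogCoeffs

open Filter Topology Metric Set Real
open scoped ComplexOrder

theorem exists_first_exit {E X : Type*} [NormedAddCommGroup E] [NormedSpace ℝ E] [ProperSpace E]
    [TopologicalSpace X] {u : E → X} {W : Set X} {z₁ : E}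
    (hu : ContinuousOn u (closedBall 0 ‖z₁‖)) (hW : IsOpen W) (h0 : u 0 ∈ W) (h1 : u z₁ ∉ W) :
    ∃ z₀, ‖z₀‖ ≤ ‖z₁‖ ∧ u z₀ ∈ frontier W ∧ MapsTo u (ball 0 ‖z₀‖) W := by
  have hcompact : IsCompact (closedBall 0 ‖z₁‖ ∩ u ⁻¹' Wᶜ) :=
    (isCompact_closedBall _ _).of_isClosed_subset
      (hu.preimage_isClosed_of_isClosed isClosed_closedBall hW.isClosed_compl) inter_subset_left
  obtain ⟨z₀, ⟨hz₀, hexit⟩, hmin⟩ :=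
    hcompact.exists_isMinOn ⟨z₁, by simp, h1⟩ continuous_norm.continuousOn
  have hz₀_le : ‖z₀‖ ≤ ‖z₁‖ := mem_closedBall_zero_iff.1 hz₀
  have hz₀_ne : ‖z₀‖ ≠ 0 := norm_ne_zero_iff.2 fun h => hexit (h ▸ h0)
  have hmaps : MapsTo u (ball 0 ‖z₀‖) W := fun z hz => by
    by_contra hzW
    rw [mem_ball_zero_iff] at hz
    exact hz.not_ge (hmin ⟨mem_closedBall_zero_iff.2 (hz.le.trans hz₀_le), hzW⟩)
  refine ⟨z₀, hz₀_le, ?_, hmaps⟩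
  rw [hW.frontier_eq]
  refine ⟨((hu z₀ hz₀).mono ?_).mem_closure ?_ hmaps, hexit⟩
  · exact ball_subset_closedBall.trans (closedBall_subset_closedBall hz₀_le)
  · rw [closure_ball _ hz₀_ne]
    exact mem_closedBall_zero_iff.2 le_rfl

theorem nonneg_mul_deriv_of_re_le {g : ℂ → ℂ} {g' z₀ : ℂ} (hg : HasDerivAt g g' z₀)
    (hle : ∀ z ∈ ball 0 ‖z₀‖, (g z).re ≤ (g z₀).re) : 0 ≤ z₀ * g' := by
  rcases eq_or_ne z₀ 0 with rfl | hz₀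
  · simp
  have hmax : IsLocalMaxOn (fun z => (g z).re) (ball 0 ‖z₀‖) z₀ :=
    eventually_nhdsWithin_of_forall hle
  have hclosure : closure (ball (0 : ℂ) ‖z₀‖) = closedBall 0 ‖z₀‖ :=
    closure_ball _ (norm_ne_zero_iff.2 hz₀)
  have hball : ball 0 ‖z₀‖ ⊆ {z | (g' * z).re ≤ (g' * z₀).re} := fun z hz => by
    have hseg : openSegment ℝ z₀ z ⊆ ball 0 ‖z₀‖ := by
      have := (convex_ball (0 : ℂ) ‖z₀‖).openSegment_closure_interior_subset_interior
        (x := z₀) (y := z) (by simp [hclosure]) (by rwa [isOpen_ball.interior_eq])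
      rwa [isOpen_ball.interior_eq] at this
    have hderiv : (g' * (z - z₀)).re ≤ 0 := by
      simpa [mul_comm] using hmax.hasFDerivWithinAt_nonpos
        (Complex.reCLM.hasFDerivAt.comp z₀ hg.complexToReal_fderiv').hasFDerivWithinAt
        (sub_mem_posTangentConeAt_of_openSegment_subset hseg)
    rwa [mul_sub, Complex.sub_re, sub_nonpos] at hderiv
  have hclosed : closedBall 0 ‖z₀‖ ⊆ {z | (g' * z).re ≤ (g' * z₀).re} :=
    hclosure ▸ closure_minimal hball (isClosed_le (by fun_prop) (by fun_prop))
  rcases eq_or_ne g' 0 with rfl | hg'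
  · simp
  have hnorm : ‖z₀ * g'‖ ≤ (z₀ * g').re := by
    have := hclosed (a := ‖z₀‖ * (starRingEnd ℂ g' / ‖g'‖)) (by simp [hg'])
    have heq : g' * (‖z₀‖ * (starRingEnd ℂ g' / ‖g'‖)) = ((‖z₀‖ * ‖g'‖ : ℝ) : ℂ) := by
      have : (‖g'‖ : ℂ) ≠ 0 := by simpa using hg'
      push_cast
      field_simp
      rw [Complex.mul_conj']
    rw [mem_ofPred_eq, heq, mul_comm g' z₀] at this
    simpa using this
  exact Complex.re_eq_norm.1 ((Complex.re_le_norm _).antisymm hnorm)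

/-- **Jack's lemma**. -/
theorem exists_one_le_mul_deriv_eq_of_norm_le {ω : ℂ → ℂ} {ω' z₀ : ℂ}
    (hω : DifferentiableOn ℂ ω (ball 0 ‖z₀‖)) (hω' : HasDerivAt ω ω' z₀) (h0 : ω 0 = 0)
    (hmax : MapsTo ω (ball 0 ‖z₀‖) (closedBall 0 ‖ω z₀‖)) (hne : ω z₀ ≠ 0) :
    ∃ m : ℝ, 1 ≤ m ∧ z₀ * ω' = m * ω z₀ := by
  have hz₀ : z₀ ≠ 0 := by rintro rfl; exact hne h0
  have hschwarz : ∀ z ∈ ball 0 ‖z₀‖, ‖ω z‖ ≤ ‖ω z₀‖ / ‖z₀‖ * ‖z‖ := fun z hz => by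
    simpa [h0] using
      Complex.dist_le_div_mul_dist_of_mapsTo_ball hω (by rwa [h0]) hz
  have hnonneg : 0 ≤ z₀ * (ω' / ω z₀ - z₀⁻¹) := by
    refine nonneg_mul_deriv_of_re_le (g := fun z => ω z / z / (ω z₀ / z₀)) ?_ fun z hz => ?_
    · refine ((hω'.div (hasDerivAt_id' z₀) hz₀).div_const (ω z₀ / z₀)).congr_deriv ?_
      field_simp
    · have h1 : (ω z₀ / z₀ / (ω z₀ / z₀)).re = 1 := by simp [hz₀, hne]
      simp only [h1]
      refine (Complex.re_le_norm _).trans ?_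
      rw [norm_div, norm_div, norm_div]
      refine div_le_one_of_le₀ ?_ (by positivity)
      exact div_le_of_le_mul₀ (norm_nonneg _) (by positivity) (hschwarz z hz)
  rw [mul_sub, mul_inv_cancel₀ hz₀, sub_nonneg] at hnonneg
  have hreal := Complex.eq_re_of_ofReal_le (r := 1) (by simpa using hnonneg)
  refine ⟨(z₀ * (ω' / ω z₀)).re, by simpa using (Complex.le_def.1 hnonneg).1, ?_⟩
  rw [← hreal]
  field_simp

theorem re_pos_of_mul_pos {a b : ℂ} (ha : 0 < a.re) (hab : 0 < a * b) : 0 < b.re := by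
  rw [Complex.pos_iff] at hab
  simp only [Complex.mul_re, Complex.mul_im] at hab
  have hmul : 0 < (a.re ^ 2 + a.im ^ 2) * b.re := by
    linear_combination a.re * hab.1 + a.im * hab.2
  exact pos_of_mul_pos_right hmul (by positivity)

/-- `y` is a holomorphic solution of `z y' + P y = 1` on the unit disk. For
`P = 1 + z f'' / f'` the solution is `y = f / (z f')`. -/
structure SolvesODE (P y : ℂ → ℂ) : Prop where
  differentiableOn : DifferentiableOn ℂ y unitDisk
  mul_deriv_eq : ∀ z ∈ unitDisk, z * deriv y z = 1 - P z * y z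

theorem unitDisk_mem_nhds {z : ℂ} (hz : z ∈ unitDisk) : unitDisk ∈ 𝓝 z := isOpen_ball.mem_nhds hz

theorem zero_mem_unitDisk : (0 : ℂ) ∈ unitDisk := by simp

namespace SolvesODE

variable {P y : ℂ → ℂ}

theorem apply_zero (hy : SolvesODE P y) : P 0 * y 0 = 1 := by
  have := hy.mul_deriv_eq 0 zero_mem_unitDisk
  rwa [zero_mul, eq_comm, sub_eq_zero, eq_comm] at this

theorem hasDerivAt (hy : SolvesODE P y) {z : ℂ} (hz : z ∈ unitDisk) :
    HasDerivAt y (deriv y z) z :=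
  (hy.differentiableOn.differentiableAt (unitDisk_mem_nhds hz)).hasDerivAt

theorem deriv_add_mul_deriv_deriv (hy : SolvesODE P y) {z : ℂ} (hz : z ∈ unitDisk)
    (hP : DifferentiableAt ℂ P z) :
    deriv y z + z * deriv (deriv y) z = -(deriv P z * y z + P z * deriv y z) := by
  have hy' := ((hy.differentiableOn.deriv isOpen_ball).differentiableAt
    (unitDisk_mem_nhds hz)).hasDerivAt
  have hlhs := (hasDerivAt_id z).mul hy'
  have hrhs := (hP.hasDerivAt.mul (hy.hasDerivAt hz)).const_sub 1
  have heq : id * deriv y =ᶠ[𝓝 z] fun x => 1 - (P * y) x :=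
    (eventually_of_mem (unitDisk_mem_nhds hz) hy.mul_deriv_eq)
  simpa using hlhs.unique (hrhs.congr_of_eventuallyEq heq)

theorem re_pos (hy : SolvesODE P y) (hP : ∀ z ∈ unitDisk, 0 < (P z).re) {z : ℂ}
    (hz : z ∈ unitDisk) : 0 < (y z).re := by
  have h0 : 0 < (y 0).re :=
    re_pos_of_mul_pos (hP 0 zero_mem_unitDisk) (hy.apply_zero ▸ one_pos)
  by_contra hyz
  have hsub : closedBall 0 ‖z‖ ⊆ unitDisk := closedBall_subset_ball (mem_ball_zero_iff.1 hz)
  obtain ⟨z₀, hz₀, hre, hmaps⟩ := exists_first_exit (W := {w : ℂ | 0 < w.re})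
    (hy.differentiableOn.continuousOn.mono hsub) (isOpen_lt continuous_const Complex.continuous_re)
    h0 hyz
  have hz₀D : z₀ ∈ unitDisk := hsub (mem_closedBall_zero_iff.2 hz₀)
  rw [Complex.frontier_setOfPred_lt_re, mem_ofPred_eq] at hre
  have hderiv : 0 ≤ z₀ * -deriv y z₀ :=
    nonneg_mul_deriv_of_re_le (hy.hasDerivAt hz₀D).neg fun x hx => by
      simpa [hre] using (hmaps hx).le
  rw [mul_neg, hy.mul_deriv_eq z₀ hz₀D, neg_sub, sub_nonneg] at hderiv
  exact (re_pos_of_mul_pos (hP z₀ hz₀D) (one_pos.trans_le hderiv)).ne' hre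

end SolvesODE

/-- `v` is conformal on `U`: holomorphic and injective. Nonvanishing of the derivative is a
consequence of these, but is carried as a field since Mathlib does not provide the implication. -/
structure UnivalentOn (v : ℂ → ℂ) (U : Set ℂ) : Prop where
  differentiableOn : DifferentiableOn ℂ v U
  injOn : InjOn v U
  deriv_ne_zero : ∀ z ∈ U, deriv v z ≠ 0

namespace UnivalentOn

variable {v : ℂ → ℂ} {U V : Set ℂ}

theorem mono (hv : UnivalentOn v V) (hUV : U ⊆ V) : UnivalentOn v U where
  differentiableOn := hv.differentiableOn.mono hUV
  injOn := hv.injOn.mono hUV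
  deriv_ne_zero := fun z hz => hv.deriv_ne_zero z (hUV hz)

theorem hasStrictDerivAt (hv : UnivalentOn v U) (hU : IsOpen U) {z : ℂ} (hz : z ∈ U) :
    HasStrictDerivAt v (deriv v z) z :=
  (hv.differentiableOn.analyticAt (hU.mem_nhds hz)).hasStrictDerivAt

theorem isOpen_image (hv : UnivalentOn v U) (hU : IsOpen U) : IsOpen (v '' U) := by
  refine isOpen_iff_mem_nhds.2 ?_
  rintro _ ⟨z, hz, rfl⟩
  rw [← (hv.hasStrictDerivAt hU hz).map_nhds_eq (hv.deriv_ne_zero z hz)]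
  exact image_mem_map (hU.mem_nhds hz)

theorem invFunOn_apply (hv : UnivalentOn v U) {z : ℂ} (hz : z ∈ U) :
    Function.invFunOn v U (v z) = z :=
  hv.injOn.leftInvOn_invFunOn hz

theorem hasDerivAt_invFunOn (hv : UnivalentOn v U) (hU : IsOpen U) {z : ℂ} (hz : z ∈ U) :
    HasDerivAt (Function.invFunOn v U) (deriv v z)⁻¹ (v z) :=
  ((hv.hasStrictDerivAt hU hz).to_local_left_inverse (hv.deriv_ne_zero z hz)
    (eventually_of_mem (hU.mem_nhds hz) fun _ => hv.invFunOn_apply)).hasDerivAt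

theorem hasDerivAt_invFunOn_comp (hv : UnivalentOn v U) (hU : IsOpen U) {u : ℂ → ℂ} {u' z ζ : ℂ}
    (hu : HasDerivAt u u' z) (hζ : ζ ∈ U) (h : u z = v ζ) :
    HasDerivAt (Function.invFunOn v U ∘ u) ((deriv v ζ)⁻¹ * u') z :=
  HasDerivAt.comp z (h ▸ hv.hasDerivAt_invFunOn hU hζ) hu

theorem differentiableOn_invFunOn (hv : UnivalentOn v U) (hU : IsOpen U) :
    DifferentiableOn ℂ (Function.invFunOn v U) (v '' U) := by
  rintro _ ⟨z, hz, rfl⟩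
  exact (hv.hasDerivAt_invFunOn hU hz).differentiableAt.differentiableWithinAt

theorem frontier_image_ball_subset (hv : UnivalentOn v U) {ρ : ℝ} (hρ : closedBall 0 ρ ⊆ U) :
    frontier (v '' ball 0 ρ) ⊆ v '' sphere 0 ρ := by
  have hopen : IsOpen (v '' ball 0 ρ) :=
    (hv.mono (ball_subset_closedBall.trans hρ)).isOpen_image isOpen_ball
  have hclosed : IsClosed (v '' closedBall 0 ρ) :=
    ((isCompact_closedBall 0 ρ).image_of_continuousOn
      (hv.differentiableOn.continuousOn.mono hρ)).isClosed
  rw [hopen.frontier_eq, sdiff_subset_iff, ← image_union, ball_union_sphere]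
  exact closure_minimal (image_mono ball_subset_closedBall) hclosed

end UnivalentOn

/-- The **Noshiro–Warschawski theorem**. -/
theorem injOn_of_re_deriv_pos {l : ℂ → ℂ} {H : Set ℂ} (hH : Convex ℝ H)
    (hl : ∀ s ∈ H, 0 < (deriv l s).re) : InjOn l H := by
  intro a ha b hb hab
  by_contra hne
  have hderiv : ∀ t ∈ Icc (0 : ℝ) 1,
      HasDerivAt (fun t : ℝ => (starRingEnd ℂ (b - a) * l (a + t * (b - a))).re)
        (Complex.normSq (b - a) * (deriv l (a + t * (b - a))).re) t ∧
      0 < (deriv l (a + t * (b - a))).re := by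
    intro t ht
    have hpos := hl _ (by simpa using hH.add_smul_sub_mem ha hb ht)
    have hd : DifferentiableAt ℂ l (a + t * (b - a)) :=
      differentiableAt_of_deriv_ne_zero fun h => by simp [h] at hpos
    have hline : HasDerivAt (fun x : ℂ => a + x * (b - a)) (b - a) (t : ℂ) := by
      simpa using ((hasDerivAt_id' (t : ℂ)).mul_const (b - a)).const_add a
    have hcomp := (hd.hasDerivAt.comp (t : ℂ) hline).const_mul (starRingEnd ℂ (b - a))
    refine ⟨hcomp.real_of_complex.congr_deriv ?_, hpos⟩
    rw [← Complex.re_ofReal_mul, ← Complex.mul_conj]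
    congr 1
    ring
  obtain ⟨t, ht, hzero⟩ := exists_hasDerivAt_eq_zero zero_lt_one
    (fun t ht => (hderiv t ht).1.continuousAt.continuousWithinAt) (by simp [hab])
    fun t ht => (hderiv t (Ioo_subset_Icc_self ht)).1
  have hnormSq : 0 < Complex.normSq (b - a) := Complex.normSq_pos.2 (sub_ne_zero.2 (Ne.symm hne))
  exact (mul_pos hnormSq (hderiv t (Ioo_subset_Icc_self ht)).2).ne' hzero

/-- **Kaplan's criterion**: close-to-convex functions are univalent. -/
theorem UnivalentOn.of_re_deriv_div_pos {F h : ℂ → ℂ} {U : Set ℂ} (hU : IsOpen U)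
    (hh : UnivalentOn h U) (hconvex : Convex ℝ (h '' U))
    (hre : ∀ z ∈ U, 0 < (deriv F z / deriv h z).re) : UnivalentOn F U := by
  have hne : ∀ z ∈ U, deriv F z ≠ 0 := fun z hz h0 => by
    simpa [h0] using hre z hz
  have hF : ∀ z ∈ U, DifferentiableAt ℂ F z := fun z hz =>
    differentiableAt_of_deriv_ne_zero (hne z hz)
  have hinj : InjOn (F ∘ Function.invFunOn h U) (h '' U) := by
    refine injOn_of_re_deriv_pos hconvex ?_
    rintro _ ⟨z, hz, rfl⟩
    have hd := (hF z hz).hasDerivAt.comp_of_eq (h z) (hh.hasDerivAt_invFunOn hU hz)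
      (hh.invFunOn_apply hz).symm
    rw [hd.deriv, ← div_eq_mul_inv]
    exact hre z hz
  refine ⟨fun z hz => (hF z hz).differentiableWithinAt, fun a ha b hb hab => ?_, hne⟩
  refine hh.injOn ha hb (hinj (mem_image_of_mem h ha) (mem_image_of_mem h hb) ?_)
  simpa [hh.invFunOn_apply ha, hh.invFunOn_apply hb] using hab

/-- `p` is subordinate to `q` on the unit disk, written `p ≺ q`: it factors as `q ∘ ω` for some
holomorphic self-map `ω` of the disk which fixes the origin. -/
def Subordinate (p q : ℂ → ℂ) : Prop :=
  ∃ ω : ℂ → ℂ, DifferentiableOn ℂ ω unitDisk ∧ MapsTo ω unitDisk unitDisk ∧ ω 0 = 0 ∧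
    ∀ z ∈ unitDisk, p z = q (ω z)

theorem UnivalentOn.subordinate {u v : ℂ → ℂ} (hv : UnivalentOn v unitDisk)
    (hu : DifferentiableOn ℂ u unitDisk) (h0 : u 0 = v 0)
    (hmaps : MapsTo u unitDisk (v '' unitDisk)) : Subordinate u v :=
  ⟨Function.invFunOn v unitDisk ∘ u, (hv.differentiableOn_invFunOn isOpen_ball).comp hu hmaps,
    fun _ hz => Function.invFunOn_mem (hmaps hz),
    by simp [h0, hv.invFunOn_apply zero_mem_unitDisk],
    fun _ hz => (Function.invFunOn_eq (hmaps hz)).symm⟩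

theorem UnivalentOn.exists_one_le_mul_deriv_eq {u v : ℂ → ℂ} {z₀ ζ₀ : ℂ}
    (hv : UnivalentOn v unitDisk) (hu : DifferentiableOn ℂ u unitDisk) (h0 : u 0 = v 0)
    (hz₀ : z₀ ∈ unitDisk) (hζ₀ : ζ₀ ∈ unitDisk) (hζ₀_ne : ζ₀ ≠ 0) (heq : u z₀ = v ζ₀)
    (hmaps : MapsTo u (ball 0 ‖z₀‖) (v '' ball 0 ‖ζ₀‖)) :
    ∃ m : ℝ, 1 ≤ m ∧ z₀ * deriv u z₀ = m * (ζ₀ * deriv v ζ₀) := by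
  have hballD : ∀ {z : ℂ}, z ∈ unitDisk → ball 0 ‖z‖ ⊆ unitDisk := fun hz =>
    ball_subset_ball (mem_ball_zero_iff.1 hz).le
  set ω := Function.invFunOn v unitDisk ∘ u with hω
  have hω0 : ω 0 = 0 := by
    rw [hω, Function.comp_apply, h0, hv.invFunOn_apply zero_mem_unitDisk]
  have hωz₀ : ω z₀ = ζ₀ := by rw [hω, Function.comp_apply, heq, hv.invFunOn_apply hζ₀]
  have hωdiff : DifferentiableOn ℂ ω (ball 0 ‖z₀‖) :=
    (hv.differentiableOn_invFunOn isOpen_ball).comp (hu.mono (hballD hz₀))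
      (hmaps.mono_right (image_mono (hballD hζ₀)))
  have hωmaps : MapsTo ω (ball 0 ‖z₀‖) (closedBall 0 ‖ω z₀‖) := fun z hz => by
    obtain ⟨ζ, hζ, hζu⟩ := hmaps hz
    rw [hωz₀, hω, Function.comp_apply, ← hζu, hv.invFunOn_apply (hballD hζ₀ hζ)]
    exact ball_subset_closedBall hζ
  obtain ⟨m, hm, hmeq⟩ := exists_one_le_mul_deriv_eq_of_norm_le hωdiff
    (hv.hasDerivAt_invFunOn_comp isOpen_ball
      (hu.differentiableAt (unitDisk_mem_nhds hz₀)).hasDerivAt hζ₀ heq) hω0 hωmaps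
    (hωz₀.trans_ne hζ₀_ne)
  have hderiv := hv.deriv_ne_zero ζ₀ hζ₀
  rw [hωz₀] at hmeq
  field_simp at hmeq
  exact ⟨m, hm, by linear_combination hmeq⟩

theorem UnivalentOn.exists_contact {u v : ℂ → ℂ} (hv : UnivalentOn v unitDisk)
    (hu : DifferentiableOn ℂ u unitDisk) (h0 : u 0 = v 0)
    (hmaps : ¬ MapsTo u unitDisk (v '' unitDisk)) :
    ∃ z₀ ∈ unitDisk, ∃ ζ₀ ∈ unitDisk, ‖z₀‖ < ‖ζ₀‖ ∧ u z₀ = v ζ₀ ∧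
      ∃ m : ℝ, 1 ≤ m ∧ z₀ * deriv u z₀ = m * (ζ₀ * deriv v ζ₀) := by
  obtain ⟨z₁, hz₁, hz₁_exit⟩ : ∃ z₁ ∈ unitDisk, u z₁ ∉ v '' unitDisk := by
    simpa only [MapsTo, not_forall, exists_prop] using hmaps
  obtain ⟨ρ, hz₁ρ, hρ⟩ := exists_between (mem_ball_zero_iff.1 hz₁)
  have hρ_pos : 0 < ρ := (norm_nonneg z₁).trans_lt hz₁ρ
  have hballD : ball 0 ρ ⊆ unitDisk := ball_subset_ball hρ.le
  have hz₁D : closedBall 0 ‖z₁‖ ⊆ unitDisk := closedBall_subset_ball (mem_ball_zero_iff.1 hz₁)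
  obtain ⟨z₀, hz₀_le, hfrontier, hz₀_maps⟩ := exists_first_exit (W := v '' ball 0 ρ)
    (hu.continuousOn.mono hz₁D) ((hv.mono hballD).isOpen_image isOpen_ball)
    (h0 ▸ mem_image_of_mem v (mem_ball_self hρ_pos)) fun h => hz₁_exit (image_mono hballD h)
  obtain ⟨ζ₀, hζ₀, hζ₀u⟩ := hv.frontier_image_ball_subset (closedBall_subset_ball hρ) hfrontier
  obtain rfl : ‖ζ₀‖ = ρ := mem_sphere_zero_iff_norm.1 hζ₀
  have hz₀D : z₀ ∈ unitDisk := hz₁D (mem_closedBall_zero_iff.2 hz₀_le)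
  have hζ₀D : ζ₀ ∈ unitDisk := mem_ball_zero_iff.2 hρ
  exact ⟨z₀, hz₀D, ζ₀, hζ₀D, hz₀_le.trans_lt hz₁ρ, hζ₀u.symm,
    hv.exists_one_le_mul_deriv_eq hu h0 hz₀D hζ₀D (norm_pos_iff.1 hρ_pos) hζ₀u.symm hz₀_maps⟩

theorem Subordinate.inv {p q : ℂ → ℂ} (h : Subordinate p q) : Subordinate p⁻¹ q⁻¹ := by
  obtain ⟨ω, hω, hmaps, hω0, hpq⟩ := h
  exact ⟨ω, hω, hmaps, hω0, fun z hz => congrArg (·⁻¹) (hpq z hz)⟩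

theorem half_lt_re_inv_one_sub_iff {x : ℂ} : 1 / 2 < ((1 - x)⁻¹).re ↔ ‖x‖ < 1 := by
  rcases eq_or_ne x 1 with rfl | hx
  · norm_num
  have hpos : 0 < Complex.normSq (1 - x) := Complex.normSq_pos.2 (sub_ne_zero.2 hx.symm)
  have hnormSq : Complex.normSq (1 - x) = 1 - 2 * x.re + ‖x‖ ^ 2 := by
    rw [Complex.normSq_sub, Complex.normSq_eq_norm_sq x]
    simp only [map_one, one_mul, Complex.conj_re]
    ring
  rw [Complex.inv_re, lt_div_iff₀ hpos, hnormSq, Complex.sub_re, Complex.one_re,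
    ← sq_lt_one_iff₀ (norm_nonneg x)]
  constructor <;> intro h <;> linarith

theorem one_sub_ne_zero {x : ℂ} (hx : ‖x‖ < 1) : 1 - x ≠ 0 := fun h => by
  rw [← sub_eq_zero.1 h, norm_one] at hx
  exact lt_irrefl _ hx

theorem re_one_sub_mul_one_sub_div_pos {a b : ℂ} (ha : ‖a‖ < 1) (hb : ‖b‖ < 1) :
    0 < ((1 - a) * (1 - b) / (1 - a * b)).re := by
  have hab : ‖a * b‖ < 1 := by
    rw [norm_mul]
    exact mul_lt_one_of_nonneg_of_lt_one_left (norm_nonneg a) ha hb.le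
  have hre : 0 < ((1 - a)⁻¹ + (1 - b)⁻¹ - 1).re := by
    have := half_lt_re_inv_one_sub_iff.2 ha
    have := half_lt_re_inv_one_sub_iff.2 hb
    rw [Complex.sub_re, Complex.add_re, Complex.one_re]
    linarith
  refine re_pos_of_mul_pos hre (lt_of_lt_of_eq one_pos ?_)
  field_simp [one_sub_ne_zero ha, one_sub_ne_zero hb, one_sub_ne_zero hab]
  ring

theorem hasDerivAt_inv_one_sub {z : ℂ} (hz : 1 - z ≠ 0) :
    HasDerivAt (fun z : ℂ => (1 - z)⁻¹) ((1 - z) ^ 2)⁻¹ z :=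
  (((hasDerivAt_id' z).const_sub 1).inv hz).congr_deriv (by ring)

theorem univalentOn_inv_one_sub : UnivalentOn (fun z => (1 - z)⁻¹) unitDisk where
  differentiableOn := fun _ hz => (hasDerivAt_inv_one_sub
    (one_sub_ne_zero (mem_ball_zero_iff.1 hz))).differentiableAt.differentiableWithinAt
  injOn := fun _ _ _ _ hab => by simpa using hab
  deriv_ne_zero := fun _ hz => by
    have hz1 := one_sub_ne_zero (mem_ball_zero_iff.1 hz)
    rw [(hasDerivAt_inv_one_sub hz1).deriv]
    exact inv_ne_zero (pow_ne_zero 2 hz1)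

theorem image_inv_one_sub_unitDisk :
    (fun z : ℂ => (1 - z)⁻¹) '' unitDisk = {s | 1 / 2 < s.re} := by
  ext s
  simp only [mem_image, mem_ball_zero_iff, mem_ofPred_eq, ← half_lt_re_inv_one_sub_iff]
  exact ⟨fun ⟨_, hz, h⟩ => h ▸ hz, fun hs => ⟨1 - s⁻¹, by simpa using hs, by simp⟩⟩

/-- The map `1 + c z / (1 - z)` of the disk onto the half-plane `{Re w > 1 - c / 2}` that enters
the definition of `ℱ(c)`. -/
noncomputable def halfPlaneMap (c : ℝ) (z : ℂ) : ℂ := 1 + c * z / (1 - z)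

section halfPlaneMap

variable {c : ℝ} {z : ℂ}

theorem halfPlaneMap_zero : halfPlaneMap c 0 = 1 := by simp [halfPlaneMap]

theorem halfPlaneMap_eq_inv_one_sub (hz : 1 - z ≠ 0) :
    halfPlaneMap c z = 1 + c * ((1 - z)⁻¹ - 1) := by
  rw [halfPlaneMap]
  field_simp
  ring

theorem hasDerivAt_halfPlaneMap (hz : 1 - z ≠ 0) :
    HasDerivAt (halfPlaneMap c) (c / (1 - z) ^ 2) z := by
  refine ((((hasDerivAt_id' z).const_mul (c : ℂ)).div ((hasDerivAt_id' z).const_sub 1)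
    hz).const_add 1).congr_deriv ?_
  ring

theorem halfPlaneMap_sub_halfPlaneMap {a b : ℂ} (ha : 1 - a ≠ 0) (hb : 1 - b ≠ 0) :
    halfPlaneMap c a - halfPlaneMap c b = c * (a - b) / ((1 - a) * (1 - b)) := by
  rw [halfPlaneMap, halfPlaneMap]
  field_simp
  ring

theorem lt_re_halfPlaneMap (hc : 0 < c) (hz : z ∈ unitDisk) :
    1 - c / 2 < (halfPlaneMap c z).re := by
  rw [mem_ball_zero_iff] at hz
  rw [halfPlaneMap_eq_inv_one_sub (one_sub_ne_zero hz), Complex.add_re, Complex.re_ofReal_mul,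
    Complex.sub_re, Complex.one_re]
  nlinarith [half_lt_re_inv_one_sub_iff.2 hz]

theorem subordinate_halfPlaneMap {p : ℂ → ℂ} (hc : 0 < c) (hp : DifferentiableOn ℂ p unitDisk)
    (hp0 : p 0 = 1) (hre : ∀ z ∈ unitDisk, 1 - c / 2 < (p z).re) :
    Subordinate p (halfPlaneMap c) := by
  have hc0 : (c : ℂ) ≠ 0 := Complex.ofReal_ne_zero.2 hc.ne'
  have hs : ∀ z ∈ unitDisk, 1 / 2 < (1 + (p z - 1) / c).re := fun z hz => by
    rw [Complex.add_re, Complex.div_ofReal_re, Complex.sub_re, Complex.one_re,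
      ← sub_lt_iff_lt_add', lt_div_iff₀ hc]
    linarith [hre z hz]
  have hs0 : ∀ z ∈ unitDisk, 1 + (p z - 1) / c ≠ 0 := fun z hz h => by
    have := hs z hz
    norm_num [h] at this
  refine ⟨fun z => 1 - (1 + (p z - 1) / c)⁻¹, ?_, fun z hz => ?_, by simp [hp0], fun z hz => ?_⟩
  · exact (((((hp.sub_const 1).div_const _).const_add 1).inv hs0).const_sub 1)
  · rw [mem_ball_zero_iff, ← half_lt_re_inv_one_sub_iff]
    simpa only [sub_sub_cancel, inv_inv] using hs z hz
  · rw [halfPlaneMap_eq_inv_one_sub (by simpa using hs0 z hz)]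
    simp only [sub_sub_cancel, inv_inv]
    field_simp
    ring

end halfPlaneMap

namespace SolvesODE

variable {c : ℝ} {p u v : ℂ → ℂ}

theorem re_pos_of_halfPlaneMap (hv : SolvesODE (halfPlaneMap c) v) (hc : 0 < c) (hc2 : c ≤ 2)
    {z : ℂ} (hz : z ∈ unitDisk) : 0 < (v z).re :=
  hv.re_pos (fun z hz => by linarith [lt_re_halfPlaneMap hc hz]) hz

theorem ne_zero_of_halfPlaneMap (hv : SolvesODE (halfPlaneMap c) v) (hc : 0 < c) (hc2 : c ≤ 2)
    {z : ℂ} (hz : z ∈ unitDisk) : v z ≠ 0 := fun h => by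
  simpa [h] using hv.re_pos_of_halfPlaneMap hc hc2 hz

/-- The logarithmic derivative of `v`, relative to `1 / (1 - z)`, solves an equation of the same
type, so its real part can be controlled by `SolvesODE.re_pos`. -/
theorem logDeriv_of_halfPlaneMap (hv : SolvesODE (halfPlaneMap c) v) (hc : 0 < c)
    (hv0 : ∀ z ∈ unitDisk, v z ≠ 0) :
    SolvesODE (fun z => (1 + z) / (1 - z) + (v z)⁻¹)
      (fun z => -((1 - z) ^ 2 * deriv v z / v z) / c) := by
  have hc0 : (c : ℂ) ≠ 0 := Complex.ofReal_ne_zero.2 hc.ne'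
  have hv' := hv.differentiableOn.deriv isOpen_ball
  refine ⟨((((differentiableOn_const 1).sub differentiableOn_id).pow 2).mul hv').div
    hv.differentiableOn hv0 |>.neg.div_const _, fun z hz => ?_⟩
  have hz1 := one_sub_ne_zero (mem_ball_zero_iff.1 hz)
  have hvz := hv0 z hz
  have hsq : HasDerivAt (fun z : ℂ => (1 - z) ^ 2) (-2 * (1 - z)) z :=
    (((hasDerivAt_id' z).const_sub 1).pow 2).congr_deriv (by push_cast; ring)
  have hderiv := (((hsq.mul (hv'.differentiableAt (unitDisk_mem_nhds hz)).hasDerivAt).div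
    (hv.hasDerivAt hz) hvz).neg.div_const (c : ℂ)).deriv
  have hode := hv.mul_deriv_eq z hz
  have hode' := hv.deriv_add_mul_deriv_deriv hz (hasDerivAt_halfPlaneMap hz1).differentiableAt
  rw [(hasDerivAt_halfPlaneMap hz1).deriv] at hode'
  rw [halfPlaneMap] at hode hode'
  field_simp at hode hode'
  refine (congrArg (z * ·) hderiv).trans ?_
  simp only [Pi.mul_apply]
  field_simp
  linear_combination (-v z) * hode' + (1 - z) * deriv v z * hode

theorem re_logDeriv_pos (hv : SolvesODE (halfPlaneMap c) v) (hc : 0 < c) (hc2 : c ≤ 2)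
    {z : ℂ} (hz : z ∈ unitDisk) : 0 < (-((1 - z) ^ 2 * deriv v z / v z)).re := by
  have hpos := (hv.logDeriv_of_halfPlaneMap hc fun _ => hv.ne_zero_of_halfPlaneMap hc hc2).re_pos
    (fun z hz => ?_) hz
  · rwa [Complex.div_ofReal_re, div_pos_iff_of_pos_right hc] at hpos
  · have hz1 : ‖z‖ < 1 := mem_ball_zero_iff.1 hz
    have hcayley : (1 + z) / (1 - z) = (2 : ℝ) * (1 - z)⁻¹ - 1 := by
      field_simp [one_sub_ne_zero hz1]
      push_cast
      ring
    have hinv : 0 < ((v z)⁻¹).re := by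
      refine re_pos_of_mul_pos (hv.re_pos_of_halfPlaneMap hc hc2 hz) ?_
      rw [mul_inv_cancel₀ (hv.ne_zero_of_halfPlaneMap hc hc2 hz)]
      exact one_pos
    rw [Complex.add_re, hcayley, Complex.sub_re, Complex.re_ofReal_mul, Complex.one_re]
    linarith [half_lt_re_inv_one_sub_iff.2 hz1]

theorem univalentOn (hv : SolvesODE (halfPlaneMap c) v) (hc : 0 < c) (hc2 : c ≤ 2) :
    UnivalentOn v unitDisk := by
  have hlog : ∀ z ∈ unitDisk, HasDerivAt (fun z => -Complex.log (v z)) (-(deriv v z / v z)) z :=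
    fun z hz => ((hv.hasDerivAt hz).clog (Or.inl (hv.re_pos_of_halfPlaneMap hc hc2 hz))).neg
  have hlog_univalent : UnivalentOn (fun z => -Complex.log (v z)) unitDisk := by
    refine .of_re_deriv_div_pos isOpen_ball univalentOn_inv_one_sub ?_ fun z hz => ?_
    · rw [image_inv_one_sub_unitDisk]
      exact convex_halfSpace_re_gt _
    · have hderiv : -(deriv v z / v z) / ((1 - z) ^ 2)⁻¹ = -((1 - z) ^ 2 * deriv v z / v z) := by
        rw [div_inv_eq_mul]
        ring
      rw [(hlog z hz).deriv,
        (hasDerivAt_inv_one_sub (one_sub_ne_zero (mem_ball_zero_iff.1 hz))).deriv, hderiv]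
      exact hv.re_logDeriv_pos hc hc2 hz
  refine ⟨hv.differentiableOn, fun a ha b hb hab => hlog_univalent.injOn ha hb (by simp only [hab]),
    fun z hz h => ?_⟩
  simpa [h] using hv.re_logDeriv_pos hc hc2 hz

theorem lt_one_of_mul_deriv_eq (hv : SolvesODE (halfPlaneMap c) v) (hc : 0 < c) (hc2 : c ≤ 2)
    {w ζ : ℂ} {m : ℝ} (hζ : ζ ∈ unitDisk) (hw : ‖w‖ < ‖ζ‖)
    (hm : m * (ζ * deriv v ζ) = 1 - halfPlaneMap c w * v ζ) : m < 1 := by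
  have hζ1 : ‖ζ‖ < 1 := mem_ball_zero_iff.1 hζ
  have hζ_ne : ζ ≠ 0 := norm_pos_iff.1 ((norm_nonneg w).trans_lt hw)
  have hwζ : ‖w / ζ‖ < 1 := by rwa [norm_div, div_lt_one (norm_pos_iff.2 hζ_ne)]
  have n1 := one_sub_ne_zero hζ1
  have n2 := one_sub_ne_zero (hw.trans hζ1)
  have hvζ := hv.ne_zero_of_halfPlaneMap hc hc2 hζ
  have hdiff : (m - 1) * (ζ * deriv v ζ) = v ζ * (c * (ζ - w) / ((1 - ζ) * (1 - w))) := by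
    rw [← halfPlaneMap_sub_halfPlaneMap n1 n2]
    linear_combination hm - hv.mul_deriv_eq ζ hζ
  have hkey : ((1 - m : ℝ) : ℂ) * -((1 - ζ) ^ 2 * deriv v ζ / v ζ) =
      c * ((1 - ζ) * (1 - w / ζ) / (1 - ζ * (w / ζ))) := by
    rw [mul_div_cancel₀ _ hζ_ne]
    field_simp at hdiff ⊢
    push_cast
    linear_combination hdiff
  have hre := congrArg Complex.re hkey
  rw [Complex.re_ofReal_mul, Complex.re_ofReal_mul] at hre
  have hpos := hre ▸ mul_pos hc (re_one_sub_mul_one_sub_div_pos hζ1 hwζ)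
  exact sub_pos.1 (pos_of_mul_pos_left hpos (hv.re_logDeriv_pos hc hc2 hζ).le)

theorem subordinate (hu : SolvesODE p u) (hv : SolvesODE (halfPlaneMap c) v) (hc : 0 < c)
    (hc2 : c ≤ 2) (hp : Subordinate p (halfPlaneMap c)) : Subordinate u v := by
  obtain ⟨ω, hω, hωmaps, hω0, hpω⟩ := hp
  have hp0 : p 0 = 1 := by rw [hpω 0 zero_mem_unitDisk, hω0, halfPlaneMap_zero]
  have hu0 : u 0 = 1 := by simpa [hp0] using hu.apply_zero
  have hv0 : v 0 = 1 := by simpa [halfPlaneMap_zero] using hv.apply_zero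
  have huv0 : u 0 = v 0 := hu0.trans hv0.symm
  have hv_univalent := hv.univalentOn hc hc2
  refine hv_univalent.subordinate hu.differentiableOn huv0 (by_contra fun hmaps => ?_)
  obtain ⟨z₀, hz₀, ζ₀, hζ₀, hlt, heq, m, hm, hderiv⟩ :=
    hv_univalent.exists_contact hu.differentiableOn huv0 hmaps
  have hschwarz : ‖ω z₀‖ ≤ ‖z₀‖ := Complex.norm_le_norm_of_mapsTo_ball hω
    (hωmaps.mono_right ball_subset_closedBall) hω0 (mem_ball_zero_iff.1 hz₀)
  refine hm.not_gt (hv.lt_one_of_mul_deriv_eq hc hc2 hζ₀ (hschwarz.trans_lt hlt) ?_)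
  rw [← hderiv, ← heq, ← hpω z₀ hz₀, hu.mul_deriv_eq z₀ hz₀]

end SolvesODE

/-- The functional `1 + z f''(z) / f'(z)` whose real part measures the convexity of `f`. -/
noncomputable def convexityFunctional (f : ℂ → ℂ) (z : ℂ) : ℂ :=
  1 + z * deriv (deriv f) z / deriv f z

/-- The quotient `z f'(z) / f(z)` of a function vanishing at the origin. Dividing by
`dslope f 0 z`, which is `f(z) / z` for `z ≠ 0`, fills in the removable singularity. -/
noncomputable def starlikeQuotient (f : ℂ → ℂ) (z : ℂ) : ℂ := deriv f z / dslope f 0 z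

section starlikeQuotient

variable {f : ℂ → ℂ}

theorem convexityFunctional_zero : convexityFunctional f 0 = 1 := by simp [convexityFunctional]

theorem differentiableOn_convexityFunctional (hf : DifferentiableOn ℂ f unitDisk)
    (hf' : ∀ z ∈ unitDisk, deriv f z ≠ 0) :
    DifferentiableOn ℂ (convexityFunctional f) unitDisk :=
  ((differentiableOn_id.mul ((hf.deriv isOpen_ball).deriv isOpen_ball)).div
    (hf.deriv isOpen_ball) hf').const_add 1

theorem apply_zero_add_mul_dslope (F : ℂ → ℂ) (z : ℂ) : F 0 + z * dslope F 0 z = F z := by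
  have h := sub_smul_dslope F 0 z
  rw [sub_zero, smul_eq_mul] at h
  rw [h, add_sub_cancel]

theorem differentiableOn_dslope_zero (hf : DifferentiableOn ℂ f unitDisk) :
    DifferentiableOn ℂ (dslope f 0) unitDisk :=
  (Complex.differentiableOn_dslope (unitDisk_mem_nhds zero_mem_unitDisk)).2 hf

theorem mul_dslope_zero (h0 : f 0 = 0) (z : ℂ) : z * dslope f 0 z = f z := by
  simpa only [h0, zero_add] using apply_zero_add_mul_dslope f z

theorem starlikeQuotient_zero (h : deriv f 0 ≠ 0) : starlikeQuotient f 0 = 1 := by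
  rw [starlikeQuotient, dslope_same, div_self h]

theorem starlikeQuotient_of_ne_zero (h0 : f 0 = 0) {z : ℂ} (hz : z ≠ 0) :
    starlikeQuotient f z = z * deriv f z / f z := by
  rw [starlikeQuotient, ← mul_dslope_zero h0 z, mul_div_mul_left _ _ hz]

theorem dslope_add_mul_deriv_dslope (hf : DifferentiableOn ℂ f unitDisk) (h0 : f 0 = 0) {z : ℂ}
    (hz : z ∈ unitDisk) : dslope f 0 z + z * deriv (dslope f 0) z = deriv f z := by
  have hg := (differentiableOn_dslope_zero hf).differentiableAt (unitDisk_mem_nhds hz)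
  have hfun : (fun x => x) * dslope f 0 = f := funext (mul_dslope_zero h0)
  simpa only [hfun, one_mul] using ((hasDerivAt_id' z).mul hg.hasDerivAt).deriv.symm

theorem solvesODE_inv_starlikeQuotient (hf : DifferentiableOn ℂ f unitDisk) (h0 : f 0 = 0)
    (hf' : ∀ z ∈ unitDisk, deriv f z ≠ 0) :
    SolvesODE (convexityFunctional f) (starlikeQuotient f)⁻¹ := by
  have hinv : (starlikeQuotient f)⁻¹ = dslope f 0 / deriv f := funext fun z => inv_div _ _
  have hg := differentiableOn_dslope_zero hf
  refine hinv ▸ ⟨hg.div (hf.deriv isOpen_ball) hf', fun z hz => ?_⟩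
  have hgz := (hg.differentiableAt (unitDisk_mem_nhds hz)).hasDerivAt
  have hfz := ((hf.deriv isOpen_ball).differentiableAt (unitDisk_mem_nhds hz)).hasDerivAt
  have hne := hf' z hz
  rw [(hgz.div hfz hne).deriv, Pi.div_apply, convexityFunctional]
  field_simp
  linear_combination deriv f z * dslope_add_mul_deriv_dslope hf h0 hz

end starlikeQuotient

namespace ClassF

variable {c : ℝ} {f : ℂ → ℂ}

theorem starlikeQuotient_zero (hf : ClassF c f) : starlikeQuotient f 0 = 1 :=
  LogCoeffs.starlikeQuotient_zero (hf.deriv_ne_zero 0 zero_mem_unitDisk)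

theorem solvesODE (hf : ClassF c f) : SolvesODE (convexityFunctional f) (starlikeQuotient f)⁻¹ :=
  solvesODE_inv_starlikeQuotient hf.analytic hf.map_zero hf.deriv_ne_zero

theorem inv_starlikeQuotient_ne_zero (hf : ClassF c f) (hc2 : c ≤ 2) {z : ℂ} (hz : z ∈ unitDisk) :
    (starlikeQuotient f)⁻¹ z ≠ 0 := fun h => by
  have hre : 0 < ((starlikeQuotient f)⁻¹ z).re :=
    hf.solvesODE.re_pos (fun z hz => lt_of_le_of_lt (by linarith) (hf.re_gt z hz)) hz
  simp [h] at hre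

theorem differentiableOn_starlikeQuotient (hf : ClassF c f) (hc2 : c ≤ 2) :
    DifferentiableOn ℂ (starlikeQuotient f) unitDisk := by
  simpa only [inv_inv] using
    hf.solvesODE.differentiableOn.inv fun _ => hf.inv_starlikeQuotient_ne_zero hc2

theorem subordinate_convexityFunctional (hf : ClassF c f) (hc : 0 < c) :
    Subordinate (convexityFunctional f) (halfPlaneMap c) :=
  subordinate_halfPlaneMap hc (differentiableOn_convexityFunctional hf.analytic hf.deriv_ne_zero)
    convexityFunctional_zero hf.re_gt

end ClassF

section extremal

variable {c : ℝ} {z : ℂ}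

theorem one_sub_mem_slitPlane (hz : ‖z‖ < 1) : 1 - z ∈ Complex.slitPlane :=
  Or.inl (by simpa using (Complex.re_le_norm z).trans_lt hz)

theorem hasDerivAt_extremal (hz : z ∈ unitDisk) :
    HasDerivAt (extremal c) ((1 - z) ^ (-(c : ℂ))) z := by
  rw [mem_ball_zero_iff] at hz
  have hslit := one_sub_mem_slitPlane hz
  have hne := one_sub_ne_zero hz
  have hsub : HasDerivAt (fun x : ℂ => 1 - x) (-1) z := (hasDerivAt_id' z).const_sub 1
  rcases eq_or_ne c 1 with rfl | hc
  · have heq : extremal 1 = fun z => -Complex.log (1 - z) := funext fun x => if_pos rfl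
    rw [heq]
    refine (hsub.clog hslit).neg.congr_deriv ?_
    rw [Complex.ofReal_one, Complex.cpow_neg_one]
    field_simp
  · have heq : extremal c = fun z => ((1 - z) ^ (1 - (c : ℂ)) - 1) / ((c : ℂ) - 1) :=
      funext fun x => if_neg hc
    have hc1 : (c : ℂ) - 1 ≠ 0 := sub_ne_zero.2 (Complex.ofReal_ne_one.2 hc)
    rw [heq]
    refine (((hsub.cpow_const (c := 1 - (c : ℂ)) hslit).sub_const 1).div_const
      ((c : ℂ) - 1)).congr_deriv ?_
    rw [sub_sub_cancel_left]
    field_simp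
    ring

theorem deriv_extremal_ne_zero (hz : z ∈ unitDisk) : deriv (extremal c) z ≠ 0 := by
  rw [(hasDerivAt_extremal hz).deriv]
  simp [Complex.cpow_eq_zero_iff, one_sub_ne_zero (mem_ball_zero_iff.1 hz)]

theorem convexityFunctional_extremal (hz : z ∈ unitDisk) :
    convexityFunctional (extremal c) z = halfPlaneMap c z := by
  have hne := one_sub_ne_zero (mem_ball_zero_iff.1 hz)
  have hderiv : deriv (extremal c) =ᶠ[𝓝 z] fun z => (1 - z) ^ (-(c : ℂ)) :=
    eventually_of_mem (unitDisk_mem_nhds hz) fun _ hx => (hasDerivAt_extremal hx).deriv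
  have hderiv2 : HasDerivAt (fun z : ℂ => (1 - z) ^ (-(c : ℂ)))
      (c * (1 - z) ^ (-(c : ℂ)) / (1 - z)) z := by
    refine (((hasDerivAt_id' z).const_sub 1).cpow_const (c := -(c : ℂ))
      (one_sub_mem_slitPlane (mem_ball_zero_iff.1 hz))).congr_deriv ?_
    rw [Complex.cpow_sub _ _ hne, Complex.cpow_one]
    ring
  have hpow : (1 - z) ^ (-(c : ℂ)) ≠ 0 := by simp [Complex.cpow_eq_zero_iff, hne]
  rw [convexityFunctional, halfPlaneMap, hderiv.deriv_eq, hderiv.self_of_nhds, hderiv2.deriv]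
  field_simp

theorem classF_extremal (hc : 0 < c) : ClassF c (extremal c) where
  analytic := fun _ hz => (hasDerivAt_extremal hz).differentiableAt.differentiableWithinAt
  map_zero := by unfold extremal; split_ifs <;> simp
  deriv_zero := by simp [(hasDerivAt_extremal zero_mem_unitDisk).deriv]
  deriv_ne_zero := fun _ => deriv_extremal_ne_zero
  re_gt := fun _ hz => (lt_re_halfPlaneMap hc hz).trans_eq
    (congrArg Complex.re (convexityFunctional_extremal hz).symm)

theorem starlikeQuotient_extremal (hc : 0 < c) : starlikeQuotient (extremal c) = psi c := by
  have he := classF_extremal hc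
  funext z
  unfold psi
  split_ifs with h
  · rw [h, he.starlikeQuotient_zero]
  · exact starlikeQuotient_of_ne_zero he.map_zero h

theorem solvesODE_inv_psi (hc : 0 < c) : SolvesODE (halfPlaneMap c) (psi c)⁻¹ := by
  rw [← starlikeQuotient_extremal hc]
  have he := (classF_extremal hc).solvesODE
  exact ⟨he.differentiableOn, fun z hz => by
    rw [he.mul_deriv_eq z hz, convexityFunctional_extremal hz]⟩

theorem differentiableOn_psi (hc : 0 < c) (hc2 : c ≤ 2) : DifferentiableOn ℂ (psi c) unitDisk :=
  starlikeQuotient_extremal hc ▸ (classF_extremal hc).differentiableOn_starlikeQuotient hc2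

end extremal

theorem ClassF.subordinate_psi {c : ℝ} {f : ℂ → ℂ} (hf : ClassF c f) (hc : 0 < c) (hc2 : c ≤ 2) :
    Subordinate (starlikeQuotient f) (psi c) := by
  simpa only [inv_inv] using
    (hf.solvesODE.subordinate (solvesODE_inv_psi hc) hc hc2
      (hf.subordinate_convexityFunctional hc)).inv

section taylorCoeff

variable {F : ℂ → ℂ}

theorem taylorCoeff_zero : taylorCoeff F 0 = F 0 := by simp [taylorCoeff]

theorem taylorCoeff_deriv (n : ℕ) : taylorCoeff (deriv F) n = (n + 1) * taylorCoeff F (n + 1) := by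
  have : (n.factorial : ℂ) ≠ 0 := by exact_mod_cast n.factorial_ne_zero
  have : (n : ℂ) + 1 ≠ 0 := by exact_mod_cast n.succ_ne_zero
  rw [taylorCoeff, taylorCoeff, iteratedDeriv_succ', Nat.factorial_succ]
  push_cast
  field_simp

theorem taylorCoeff_dslope (hF : AnalyticAt ℂ F 0) (n : ℕ) :
    taylorCoeff (dslope F 0) n = taylorCoeff F (n + 1) := by
  have hslope := hF.hasFPowerSeriesAt.has_fpower_series_dslope_fslope
  have htaylor := AnalyticAt.hasFPowerSeriesAt ⟨_, hslope⟩
  simpa [FormalMultilinearSeries.coeff_fslope, taylorCoeff] using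
    congrArg (fun p => p.coeff n) (htaylor.eq_formalMultilinearSeries hslope)

theorem taylorCoeff_succ_of_eventuallyEq {g : ℂ → ℂ} {a : ℂ} (hg : AnalyticAt ℂ g 0)
    (hF : F =ᶠ[𝓝 0] fun z => a + z * g z) (n : ℕ) : taylorCoeff F (n + 1) = taylorCoeff g n := by
  have hderiv : HasDerivAt (fun z => a + z * g z) (g 0) 0 := by
    simpa using ((hasDerivAt_id' 0).mul hg.differentiableAt.hasDerivAt).const_add a
  have hdslope : dslope (fun z => a + z * g z) 0 = g := by
    funext z
    rcases eq_or_ne z 0 with rfl | hz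
    · rw [dslope_same, hderiv.deriv]
    · rw [dslope_of_ne _ hz, slope_def_field]
      field_simp
      ring
  rw [taylorCoeff, hF.iteratedDeriv_eq, ← taylorCoeff, ← taylorCoeff_dslope (by fun_prop), hdslope]

end taylorCoeff

namespace ClassA

variable {f : ℂ → ℂ}

theorem logCoeff_eq (hf : ClassA f) (n : ℕ) :
    logCoeff f n = taylorCoeff (fun z => Complex.log (dslope f 0 z)) n / 2 := by
  have hquotient : (fun z => if z = 0 then 1 else f z / z) = dslope f 0 := by
    funext z
    split_ifs with hz
    · rw [hz, dslope_same, hf.deriv_zero]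
    · rw [dslope_of_ne f hz, slope_def_field, hf.map_zero, sub_zero, sub_zero]
  simp only [logCoeff, ← hquotient]

theorem starlikeQuotient_eventuallyEq (hf : ClassA f) :
    starlikeQuotient f =ᶠ[𝓝 0] fun z => 1 + z * deriv (fun z => Complex.log (dslope f 0 z)) z := by
  have hg := differentiableOn_dslope_zero hf.analytic
  have hslit : ∀ᶠ z in 𝓝 (0 : ℂ), dslope f 0 z ∈ Complex.slitPlane :=
    (hg.differentiableAt (unitDisk_mem_nhds zero_mem_unitDisk)).continuousAt.eventually_mem
      (Complex.isOpen_slitPlane.mem_nhds (by simp [hf.deriv_zero]))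
  filter_upwards [hslit, unitDisk_mem_nhds zero_mem_unitDisk] with z hz hzD
  have hlog := ((hg.differentiableAt (unitDisk_mem_nhds hzD)).hasDerivAt.clog hz).deriv
  have hne : dslope f 0 z ≠ 0 := Complex.slitPlane_ne_zero hz
  rw [hlog, starlikeQuotient, ← dslope_add_mul_deriv_dslope hf.analytic hf.map_zero hzD]
  field_simp

theorem taylorCoeff_starlikeQuotient (hf : ClassA f) (n : ℕ) :
    taylorCoeff (starlikeQuotient f) (n + 1) = 2 * (n + 1) * logCoeff f (n + 1) := by
  have hlog : AnalyticAt ℂ (fun z => Complex.log (dslope f 0 z)) 0 :=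
    ((differentiableOn_dslope_zero hf.analytic).analyticAt
      (unitDisk_mem_nhds zero_mem_unitDisk)).clog (by simp [hf.deriv_zero])
  rw [taylorCoeff_succ_of_eventuallyEq hlog.deriv hf.starlikeQuotient_eventuallyEq,
    taylorCoeff_deriv, hf.logCoeff_eq]
  ring

theorem sq_mul_norm_logCoeff_sq (hf : ClassA f) (n : ℕ+) :
    (n : ℝ) ^ 2 * ‖logCoeff f n‖ ^ 2 = ‖taylorCoeff (starlikeQuotient f) n‖ ^ 2 / 4 := by
  have hcoeff : taylorCoeff (starlikeQuotient f) n = 2 * n * logCoeff f n := by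
    have h := hf.taylorCoeff_starlikeQuotient n.natPred
    rwa [← Nat.cast_add_one, n.natPred_add_one] at h
  rw [hcoeff, norm_mul, norm_mul, Complex.norm_natCast, Complex.norm_ofNat]
  ring

theorem tsum_mul_norm_logCoeff_sq (hf : ClassA f) (w : ℕ+ → ℝ) :
    ∑' n : ℕ+, ENNReal.ofReal (w n * ((n : ℝ) ^ 2 * ‖logCoeff f n‖ ^ 2)) =
      1 / 4 * ∑' n : ℕ+, ENNReal.ofReal (w n * ‖taylorCoeff (starlikeQuotient f) n‖ ^ 2) := by
  rw [← ENNReal.tsum_mul_left]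
  refine tsum_congr fun n => ?_
  rw [hf.sq_mul_norm_logCoeff_sq, ← mul_div_assoc, ENNReal.ofReal_div_of_pos four_pos,
    ENNReal.ofReal_ofNat, ENNReal.div_eq_inv_mul, one_div]

end ClassA

section circleAverage

theorem circleAverage_norm_const_add_sq {E : Type*} [NormedAddCommGroup E] [InnerProductSpace ℂ E]
    {F : ℂ → E} {c : ℂ} {r : ℝ} (hF : DiffContOnCl ℂ F (ball c |r|)) (hFc : F c = 0) (a : E) :
    circleAverage (fun z => ‖a + F z‖ ^ 2) c r =
      ‖a‖ ^ 2 + circleAverage (fun z => ‖F z‖ ^ 2) c r := by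
  have hcont : ContinuousOn F (sphere c |r|) := by
    rcases eq_or_ne r 0 with rfl | hr
    · rw [abs_zero, sphere_zero]
      exact continuousOn_singleton F c
    · exact hF.continuousOn.mono (closure_ball c (abs_pos.2 hr).ne' ▸ sphere_subset_closedBall)
  have hinner : ContinuousOn (innerSL ℂ a ∘ F) (sphere c |r|) :=
    (innerSL ℂ a).continuous.comp_continuousOn hcont
  have hmean : circleAverage (Complex.reCLM ∘ innerSL ℂ a ∘ F) c r = 0 := by
    rw [Complex.reCLM.circleAverage_comp_comm hinner.circleIntegrable',
      ((innerSL ℂ a).differentiable.comp_diffContOnCl hF).circleAverage]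
    simp [hFc]
  have hnorm : CircleIntegrable (fun z => ‖F z‖ ^ 2) c r := (hcont.norm.pow 2).circleIntegrable'
  have hcross : CircleIntegrable ((2 : ℝ) • (Complex.reCLM ∘ innerSL ℂ a ∘ F)) c r :=
    ((Complex.reCLM.continuous.comp_continuousOn hinner).const_smul (2 : ℝ)).circleIntegrable'
  have hconst : CircleIntegrable (fun _ => ‖a‖ ^ 2) c r := circleIntegrable_const _ c r
  have hexpand : (fun z => ‖a + F z‖ ^ 2) =
      (fun _ => ‖a‖ ^ 2) + (2 : ℝ) • (Complex.reCLM ∘ innerSL ℂ a ∘ F) + fun z => ‖F z‖ ^ 2 :=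
    funext fun z => by simpa using norm_add_sq (𝕜 := ℂ) a (F z)
  rw [hexpand, circleAverage_add (hconst.add hcross) hnorm, circleAverage_add hconst hcross,
    circleAverage_const, circleAverage_smul, hmean, smul_zero, add_zero]

variable {r : ℝ}

theorem diffContOnCl_ball {F : ℂ → ℂ} (hF : DifferentiableOn ℂ F unitDisk) (hr : |r| < 1) :
    DiffContOnCl ℂ F (ball 0 |r|) :=
  (hF.mono (closure_ball_subset_closedBall.trans (closedBall_subset_ball hr))).diffContOnCl

theorem sphere_subset_unitDisk (hr : |r| < 1) : sphere (0 : ℂ) |r| ⊆ unitDisk :=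
  sphere_subset_closedBall.trans (closedBall_subset_ball hr)

theorem circleIntegrable_norm_sq {F : ℂ → ℂ} (hF : DifferentiableOn ℂ F unitDisk) (hr : |r| < 1) :
    CircleIntegrable (fun z => ‖F z‖ ^ 2) 0 r :=
  ((hF.continuousOn.mono (sphere_subset_unitDisk hr)).norm.pow 2).circleIntegrable'

/-- **Littlewood's subordination inequality** for polynomials, in the quadratic mean. -/
theorem circleAverage_norm_sum_mul_pow_sq_le {ω : ℂ → ℂ} (hω : DifferentiableOn ℂ ω unitDisk)
    (hmaps : MapsTo ω unitDisk unitDisk) (hω0 : ω 0 = 0) (hr : |r| < 1) (N : ℕ) (d : ℕ → ℂ) :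
    circleAverage (fun z => ‖∑ k ∈ Finset.range N, d k * ω z ^ k‖ ^ 2) 0 r ≤
      ∑ k ∈ Finset.range N, ‖d k‖ ^ 2 := by
  induction N generalizing d with
  | zero => simp [circleAverage_const]
  | succ N ih =>
    set T : ℂ → ℂ := fun z => ∑ k ∈ Finset.range N, d (k + 1) * ω z ^ k with hT
    have hTd : DifferentiableOn ℂ T unitDisk :=
      DifferentiableOn.fun_sum fun k _ => (hω.pow k).const_mul _
    have hsplit : (fun z => ∑ k ∈ Finset.range (N + 1), d k * ω z ^ k) =
        fun z => d 0 + (ω * T) z := by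
      funext z
      rw [Finset.sum_range_succ', pow_zero, mul_one, add_comm, Pi.mul_apply, hT, Finset.mul_sum]
      exact congrArg _ (Finset.sum_congr rfl fun k _ => by ring)
    have hcontract : circleAverage (fun z => ‖(ω * T) z‖ ^ 2) 0 r ≤
        circleAverage (fun z => ‖T z‖ ^ 2) 0 r := by
      refine circleAverage_mono (circleIntegrable_norm_sq (hω.mul hTd) hr)
        (circleIntegrable_norm_sq hTd hr) fun z hz => ?_
      have hωz : ‖ω z‖ ≤ 1 := (mem_ball_zero_iff.1 (hmaps (sphere_subset_unitDisk hr hz))).le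
      rw [Pi.mul_apply, norm_mul]
      gcongr
      exact mul_le_of_le_one_left (norm_nonneg _) hωz
    calc circleAverage (fun z => ‖∑ k ∈ Finset.range (N + 1), d k * ω z ^ k‖ ^ 2) 0 r
        = ‖d 0‖ ^ 2 + circleAverage (fun z => ‖(ω * T) z‖ ^ 2) 0 r := by
          simp_rw [funext_iff.1 hsplit]
          exact circleAverage_norm_const_add_sq (diffContOnCl_ball (hω.mul hTd) hr)
            (by simp [hω0]) _
      _ ≤ ‖d 0‖ ^ 2 + ∑ k ∈ Finset.range N, ‖d (k + 1)‖ ^ 2 := by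
          gcongr
          exact hcontract.trans (ih fun k => d (k + 1))
      _ = ∑ k ∈ Finset.range (N + 1), ‖d k‖ ^ 2 := by rw [Finset.sum_range_succ', add_comm]

/-- **Bessel's inequality**: the right-hand side is the quadratic mean of a function with the
same first `N` Taylor coefficients as `F`. -/
theorem sum_norm_taylorCoeff_sq_mul_le_circleAverage {E F : ℂ → ℂ}
    (hE : DifferentiableOn ℂ E unitDisk) (hF : DifferentiableOn ℂ F unitDisk) (hr : |r| < 1)
    (N : ℕ) :
    ∑ k ∈ Finset.range N, ‖taylorCoeff F k‖ ^ 2 * r ^ (2 * k) ≤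
      circleAverage (fun z => ‖F z + z ^ N * E z‖ ^ 2) 0 r := by
  induction N generalizing F with
  | zero =>
    rw [Finset.range_zero, Finset.sum_empty]
    exact circleAverage_nonneg_of_nonneg fun z _ => by positivity
  | succ N ih =>
    set K : ℂ → ℂ := fun z => dslope F 0 z + z ^ N * E z
    have hKd : DifferentiableOn ℂ K unitDisk :=
      (differentiableOn_dslope_zero hF).add ((differentiableOn_id.pow N).mul hE)
    have hsplit (z : ℂ) : F z + z ^ (N + 1) * E z = F 0 + z * K z := by
      linear_combination -apply_zero_add_mul_dslope F z
    have hscale : circleAverage (fun z => ‖z * K z‖ ^ 2) 0 r =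
        r ^ 2 * circleAverage (fun z => ‖K z‖ ^ 2) 0 r := by
      rw [← smul_eq_mul, ← circleAverage_fun_smul]
      refine circleAverage_congr_sphere fun z hz => ?_
      simp only [norm_mul, mem_sphere_zero_iff_norm.1 hz, mul_pow, sq_abs, smul_eq_mul]
    calc ∑ k ∈ Finset.range (N + 1), ‖taylorCoeff F k‖ ^ 2 * r ^ (2 * k)
        = ‖F 0‖ ^ 2 + r ^ 2 *
            ∑ k ∈ Finset.range N, ‖taylorCoeff (dslope F 0) k‖ ^ 2 * r ^ (2 * k) := by
          have hFan := hF.analyticAt (unitDisk_mem_nhds zero_mem_unitDisk)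
          rw [Finset.sum_range_succ', add_comm, taylorCoeff_zero, mul_zero, pow_zero, mul_one,
            Finset.mul_sum]
          refine congrArg _ (Finset.sum_congr rfl fun k _ => ?_)
          rw [taylorCoeff_dslope hFan]
          ring
      _ ≤ ‖F 0‖ ^ 2 + r ^ 2 * circleAverage (fun z => ‖K z‖ ^ 2) 0 r := by
          gcongr
          exact ih (differentiableOn_dslope_zero hF)
      _ = circleAverage (fun z => ‖F z + z ^ (N + 1) * E z‖ ^ 2) 0 r := by
          simp_rw [hsplit, ← hscale]
          exact (circleAverage_norm_const_add_sq
            (diffContOnCl_ball (differentiableOn_id.mul hKd) hr) (by simp) (F 0)).symm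

end circleAverage

theorem exists_eq_sum_taylorCoeff_add_pow_mul {q : ℂ → ℂ} (hq : DifferentiableOn ℂ q unitDisk)
    (N : ℕ) :
    ∃ E : ℂ → ℂ, DifferentiableOn ℂ E unitDisk ∧
      ∀ z, q z = ∑ k ∈ Finset.range N, taylorCoeff q k * z ^ k + z ^ N * E z := by
  induction N generalizing q with
  | zero => exact ⟨q, hq, by simp⟩
  | succ N ih =>
    obtain ⟨E, hE, hexpand⟩ := ih (differentiableOn_dslope_zero hq)
    have hqan := hq.analyticAt (unitDisk_mem_nhds zero_mem_unitDisk)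
    refine ⟨E, hE, fun z => ?_⟩
    have hshift : ∑ k ∈ Finset.range N, taylorCoeff q (k + 1) * z ^ (k + 1) =
        z * ∑ k ∈ Finset.range N, taylorCoeff (dslope q 0) k * z ^ k := by
      rw [Finset.mul_sum]
      refine Finset.sum_congr rfl fun k _ => ?_
      rw [taylorCoeff_dslope hqan]
      ring
    rw [Finset.sum_range_succ', taylorCoeff_zero, pow_zero, mul_one, hshift]
    linear_combination z * hexpand z - apply_zero_add_mul_dslope q z

namespace Subordinate

variable {p q : ℂ → ℂ}

theorem differentiableOn (h : Subordinate p q) (hq : DifferentiableOn ℂ q unitDisk) :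
    DifferentiableOn ℂ p unitDisk :=
  let ⟨_, hω, hmaps, _, hpω⟩ := h
  (hq.comp hω hmaps).congr hpω

theorem apply_zero (h : Subordinate p q) : p 0 = q 0 := by
  obtain ⟨ω, -, -, hω0, hpω⟩ := h
  rw [hpω 0 zero_mem_unitDisk, hω0]

theorem sum_norm_taylorCoeff_sq_mul_le (h : Subordinate p q) (hq : DifferentiableOn ℂ q unitDisk)
    {r : ℝ} (hr : |r| < 1) (N : ℕ) :
    ∑ k ∈ Finset.range N, ‖taylorCoeff p k‖ ^ 2 * r ^ (2 * k) ≤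
      ∑ k ∈ Finset.range N, ‖taylorCoeff q k‖ ^ 2 := by
  have hp := h.differentiableOn hq
  obtain ⟨ω, hω, hmaps, hω0, hpω⟩ := h
  obtain ⟨E, hE, hexpand⟩ := exists_eq_sum_taylorCoeff_add_pow_mul hq N
  have hremainder : DifferentiableOn ℂ (fun z => -(dslope ω 0 z ^ N * E (ω z))) unitDisk :=
    (((differentiableOn_dslope_zero hω).pow N).mul (hE.comp hω hmaps)).neg
  have htruncate : EqOn (fun z => ‖p z + z ^ N * -(dslope ω 0 z ^ N * E (ω z))‖ ^ 2)
      (fun z => ‖∑ k ∈ Finset.range N, taylorCoeff q k * ω z ^ k‖ ^ 2) (sphere 0 |r|) := by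
    intro z hz
    have hz' : p z + z ^ N * -(dslope ω 0 z ^ N * E (ω z)) =
        ∑ k ∈ Finset.range N, taylorCoeff q k * ω z ^ k := by
      rw [hpω z (sphere_subset_unitDisk hr hz), hexpand (ω z), mul_neg, ← mul_assoc, ← mul_pow,
        mul_dslope_zero hω0, add_neg_cancel_right]
    simp only [hz']
  calc ∑ k ∈ Finset.range N, ‖taylorCoeff p k‖ ^ 2 * r ^ (2 * k)
      ≤ circleAverage (fun z => ‖p z + z ^ N * -(dslope ω 0 z ^ N * E (ω z))‖ ^ 2) 0 r :=
        sum_norm_taylorCoeff_sq_mul_le_circleAverage hremainder hp hr N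
    _ = circleAverage (fun z => ‖∑ k ∈ Finset.range N, taylorCoeff q k * ω z ^ k‖ ^ 2) 0 r :=
        circleAverage_congr_sphere htruncate
    _ ≤ ∑ k ∈ Finset.range N, ‖taylorCoeff q k‖ ^ 2 :=
        circleAverage_norm_sum_mul_pow_sq_le hω hmaps hω0 hr N _

/-- **Rogosinski's theorem** on the coefficients of subordinate functions. -/
theorem sum_norm_taylorCoeff_sq_le (h : Subordinate p q) (hq : DifferentiableOn ℂ q unitDisk)
    (N : ℕ) :
    ∑ k ∈ Finset.range N, ‖taylorCoeff p k‖ ^ 2 ≤ ∑ k ∈ Finset.range N, ‖taylorCoeff q k‖ ^ 2 := by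
  have hlim : Tendsto (fun r : ℝ => ∑ k ∈ Finset.range N, ‖taylorCoeff p k‖ ^ 2 * r ^ (2 * k))
      (𝓝[<] 1) (𝓝 (∑ k ∈ Finset.range N, ‖taylorCoeff p k‖ ^ 2)) :=
    (Continuous.tendsto' (by fun_prop) 1 _ (by simp)).mono_left nhdsWithin_le_nhds
  refine le_of_tendsto hlim ?_
  filter_upwards [Ioo_mem_nhdsLT (zero_lt_one : (0 : ℝ) < 1)] with r hr
  exact h.sum_norm_taylorCoeff_sq_mul_le hq (by rw [abs_of_pos hr.1]; exact hr.2) N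

theorem sum_norm_taylorCoeff_succ_sq_le (h : Subordinate p q) (hq : DifferentiableOn ℂ q unitDisk)
    (N : ℕ) :
    ∑ k ∈ Finset.range N, ‖taylorCoeff p (k + 1)‖ ^ 2 ≤
      ∑ k ∈ Finset.range N, ‖taylorCoeff q (k + 1)‖ ^ 2 := by
  have hsum := h.sum_norm_taylorCoeff_sq_le hq (N + 1)
  rw [Finset.sum_range_succ', Finset.sum_range_succ', taylorCoeff_zero, taylorCoeff_zero,
    h.apply_zero] at hsum
  exact le_of_add_le_add_right hsum

end Subordinate

section weights

theorem sum_range_mul_le_of_antitone {R : Type*} [CommRing R] [LinearOrder R]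
    [IsStrictOrderedRing R] {a b w : ℕ → R} (hw : Antitone w) (hw0 : ∀ n, 0 ≤ w n)
    (hab : ∀ N, ∑ k ∈ Finset.range N, a k ≤ ∑ k ∈ Finset.range N, b k) (N : ℕ) :
    ∑ k ∈ Finset.range N, w k * a k ≤ ∑ k ∈ Finset.range N, w k * b k := by
  -- Abel summation: the last weight times the gap of the sums bounds the gap of the weighted sums.
  have hgap : ∀ N, w N * (∑ k ∈ Finset.range N, b k - ∑ k ∈ Finset.range N, a k) ≤
      ∑ k ∈ Finset.range N, w k * b k - ∑ k ∈ Finset.range N, w k * a k := by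
    intro N
    induction N with
    | zero => simp
    | succ N ih =>
      refine (mul_le_mul_of_nonneg_right (hw N.le_succ) (sub_nonneg.2 (hab (N + 1)))).trans ?_
      simp only [Finset.sum_range_succ]
      linarith
  exact sub_nonneg.1 ((mul_nonneg (hw0 N) (sub_nonneg.2 (hab N))).trans (hgap N))

theorem tsum_ofReal_mul_le_of_antitone {a b w : ℕ → ℝ} (hw : Antitone w) (hw0 : ∀ n, 0 ≤ w n)
    (ha : ∀ n, 0 ≤ a n) (hb : ∀ n, 0 ≤ b n)
    (hab : ∀ N, ∑ k ∈ Finset.range N, a k ≤ ∑ k ∈ Finset.range N, b k) :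
    ∑' n, ENNReal.ofReal (w n * a n) ≤ ∑' n, ENNReal.ofReal (w n * b n) := by
  refine ENNReal.tsum_le_of_sum_range_le fun N => le_trans ?_ (ENNReal.sum_le_tsum (.range N))
  rw [← ENNReal.ofReal_sum_of_nonneg fun n _ => mul_nonneg (hw0 n) (ha n),
    ← ENNReal.ofReal_sum_of_nonneg fun n _ => mul_nonneg (hw0 n) (hb n)]
  exact ENNReal.ofReal_le_ofReal (sum_range_mul_le_of_antitone hw hw0 hab N)

theorem antitone_add_one_rpow_div_sq {t : ℝ} (ht : t ≤ 2) :
    Antitone fun n : ℕ+ => ((n : ℝ) + 1) ^ t / (n : ℝ) ^ 2 := by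
  have hfactor : (fun n : ℕ+ => ((n : ℝ) + 1) ^ t / (n : ℝ) ^ 2) =
      fun n : ℕ+ => ((n : ℝ) + 1) ^ (t - 2) * (1 + 1 / (n : ℝ)) ^ 2 := by
    funext n
    have : (0 : ℝ) < n := mod_cast n.pos
    rw [rpow_sub (by positivity), rpow_two]
    field_simp
  rw [hfactor]
  intro m n hmn
  have : (0 : ℝ) < m := mod_cast m.pos
  have hmn' : (m : ℝ) ≤ n := mod_cast hmn
  refine mul_le_mul ?_ (by gcongr) (by positivity) (by positivity)
  exact rpow_le_rpow_of_nonpos (by positivity) (by gcongr) (by linarith)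

theorem Subordinate.tsum_mul_norm_taylorCoeff_sq_le {p q : ℂ → ℂ} (h : Subordinate p q)
    (hq : DifferentiableOn ℂ q unitDisk) {w : ℕ+ → ℝ} (hw : Antitone w) (hw0 : ∀ n, 0 ≤ w n) :
    ∑' n : ℕ+, ENNReal.ofReal (w n * ‖taylorCoeff p n‖ ^ 2) ≤
      ∑' n : ℕ+, ENNReal.ofReal (w n * ‖taylorCoeff q n‖ ^ 2) := by
  rw [← Equiv.pnatEquivNat.symm.tsum_eq, ← Equiv.pnatEquivNat.symm.tsum_eq]
  exact tsum_ofReal_mul_le_of_antitone (hw.comp_monotone Nat.succPNat_mono) (fun n => hw0 _)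
    (fun _ => sq_nonneg _) (fun _ => sq_nonneg _) (h.sum_norm_taylorCoeff_succ_sq_le hq)

end weights

theorem ClassF.tsum_mul_norm_logCoeff_sq_le {c : ℝ} {f : ℂ → ℂ} (hf : ClassF c f) (hc : 0 < c)
    (hc2 : c ≤ 2) {w : ℕ+ → ℝ} (hw : Antitone w) (hw0 : ∀ n, 0 ≤ w n) :
    ∑' n : ℕ+, ENNReal.ofReal (w n * ((n : ℝ) ^ 2 * ‖logCoeff f n‖ ^ 2)) ≤
      1 / 4 * ∑' n : ℕ+, ENNReal.ofReal (w n * ‖taylorCoeff (psi c) n‖ ^ 2) := by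
  rw [hf.tsum_mul_norm_logCoeff_sq]
  gcongr 1 / 4 * ?_
  exact (hf.subordinate_psi hc hc2).tsum_mul_norm_taylorCoeff_sq_le
    (differentiableOn_psi hc hc2) hw hw0

end LogCoeffs

theorem mainTheorem1 (c : ℝ) (hc : c ∈ Set.Ioc (0 : ℝ) 2) :
    (∀ f : ℂ → ℂ, LogCoeffs.ClassF c f →
      (∑' n : ℕ+, ENNReal.ofReal ((n : ℝ) ^ 2 * ‖LogCoeffs.logCoeff f n‖ ^ 2) ≤
        (1 / 4) * ∑' n : ℕ+, ENNReal.ofReal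
          (‖LogCoeffs.taylorCoeff (LogCoeffs.psi c) n‖ ^ 2)) ∧
      (∀ t : ℝ, t ≤ 2 →
        ∑' n : ℕ+, ENNReal.ofReal (((n : ℝ) + 1) ^ t * ‖LogCoeffs.logCoeff f n‖ ^ 2) ≤
          (1 / 4) * ∑' n : ℕ+, ENNReal.ofReal
            (((n : ℝ) + 1) ^ t / (n : ℝ) ^ 2 *
              ‖LogCoeffs.taylorCoeff (LogCoeffs.psi c) n‖ ^ 2))) ∧
    LogCoeffs.ClassF c (LogCoeffs.extremal c) ∧
    ∑' n : ℕ+, ENNReal.ofReal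
        ((n : ℝ) ^ 2 * ‖LogCoeffs.logCoeff (LogCoeffs.extremal c) n‖ ^ 2) =
      (1 / 4) * ∑' n : ℕ+, ENNReal.ofReal
        (‖LogCoeffs.taylorCoeff (LogCoeffs.psi c) n‖ ^ 2) := by
  have hextremal := LogCoeffs.classF_extremal hc.1
  refine ⟨fun f hf => ⟨?_, fun t ht => ?_⟩, hextremal, ?_⟩
  · simpa only [one_mul] using
      hf.tsum_mul_norm_logCoeff_sq_le hc.1 hc.2 antitone_const fun _ => zero_le_one
  · have hweight (n : ℕ+) : ((n : ℝ) + 1) ^ t * ‖LogCoeffs.logCoeff f n‖ ^ 2 =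
        ((n : ℝ) + 1) ^ t / (n : ℝ) ^ 2 * ((n : ℝ) ^ 2 * ‖LogCoeffs.logCoeff f n‖ ^ 2) := by
      field_simp
    simp_rw [hweight]
    exact hf.tsum_mul_norm_logCoeff_sq_le hc.1 hc.2
      (LogCoeffs.antitone_add_one_rpow_div_sq ht) fun n => by positivity
  · rw [← LogCoeffs.starlikeQuotient_extremal hc.1]
    simpa only [one_mul] using hextremal.tsum_mul_norm_logCoeff_sq fun _ => 1
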